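/- Let $X$ be a locally convex Hausdorff real topological vector space with its Borel $\sigma$-algebra, let $(\mu_\alpha)$ be a net of Borel probability measures on $X$, and let $(t_\alpha)$ be a net in $]0,+\infty[$, indexed by the same directed set, converging to $0$. For a Borel function $h:X\to[-\infty,+\infty[$ put $$\overline\Lambda(h)=\log\limsup_\alpha\Big(\int_X e^{h/t_\alpha}\,d\mu_\alpha\Big)^{t_\alpha},\qquad \underline\Lambda(h)=\log\liminf_\alpha\Big(\int_X e^{h/t_\alpha}\,d\mu_\alpha\Big)^{t_\alpha},$$ and say that $\Lambda(h)$ exists if the limit $\lim_\alpha(\int_X e^{h/t_\alpha}d\mu_\alpha)^{t_\alpha}$ exists in $[0,+\infty]$, in which case $\Lambda(h)\in[-\infty,+\infty]$ denotes its logarithm. Let $\mathcal A$ be the set of all minima of finitely many (at least one) functions of the form $u+c$, with $u$ a continuous linear functional on $X$ and $c\in\mathbb R$, and let $\mathcal A_-=\{h\in\mathcal A: h\le 0\}$. For $h\in\mathcal A$ and $M\in\mathbb R$ let $h_M=h$ on $\{h<M\}$ and $h_M=-\infty$ on $\{h\ge M\}$. Assume that $(\mu_\alpha)$ is exponentially tight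 with respect to $(t_\alpha)$, that is, for every $\varepsilon>0$ there is a compact $K\subset X$ with $\limsup_\alpha \mu_\alpha(X\setminus K)^{t_\alpha}<\varepsilon$, and that $\Lambda(h)$ exists for every $h\in\mathcal A_-$. Then $(\mu_\alpha)$ satisfies a large deviation principle with powers $(t_\alpha)$ and a rate function $J$, that is, there is a lower semicontinuous $J:X\to[0,+\infty]$ with $$\limsup_\alpha\mu_\alpha(F)^{t_\alpha}\le\sup_{x\in F}e^{-J(x)}\ \text{ for all closed } F\subset X,\qquad \sup_{x\in G}e^{-J(x)}\le\liminf_\alpha\mu_\alpha(G)^{t_\alpha}\ \text{ for all open } G\subset X;$$ moreover $\lim_{M\to+\infty}\underline\Lambda(h_M)$ exists in $[-\infty,+\infty]$ for every $h\in\mathcal A$, and for all $x\in X$ $$J(x)=\sup_{h\in\mathcal A_-}\{h(x)-\Lambda(h)\}=\sup_{h\in\mathcal A}\{h(x)-\overline\Lambda(h)\}=\sup_{h\in\mathcal A}\{h(x)-\underline\Lambda(h)\}=\sup_{h\in\mathcal A}\{h(x)-\lim_{M\to+\infty}\underline\Lambda(h_M)\}.$$ -/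

import Mathlib

open MeasureTheory Filter Topology
open scoped ENNReal

namespace BrycLDP

noncomputable section

/-- The quantity `(∫ e^{h/t} dμ)^t ∈ [0,∞]` for a `[-∞,∞[`-valued function `h` and `t > 0`. -/
def powExp {X : Type*} [MeasurableSpace X] (μ : Measure X) (t : ℝ) (h : X → EReal) : ℝ≥0∞ :=
  (∫⁻ x, EReal.exp (h x / (t : EReal)) ∂μ) ^ t

/-- The upper functional: the logarithm of the upper limit of `(∫ e^{h/t_a} dμ_a)^{t_a}`. -/
def upperLambda {X ι : Type*} [MeasurableSpace X] (μ : ι → Measure X) (t : ι → ℝ)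
    (l : Filter ι) (h : X → EReal) : EReal :=
  ENNReal.log (limsup (fun a => powExp (μ a) (t a) h) l)

/-- The lower functional: the logarithm of the lower limit of `(∫ e^{h/t_a} dμ_a)^{t_a}`. -/
def lowerLambda {X ι : Type*} [MeasurableSpace X] (μ : ι → Measure X) (t : ι → ℝ)
    (l : Filter ι) (h : X → EReal) : EReal :=
  ENNReal.log (liminf (fun a => powExp (μ a) (t a) h) l)

/-- `Λ(h)` exists in `[-∞,∞]` and equals `c`: the limit of `(∫ e^{h/t_a} dμ_a)^{t_a}` exists
in `[0,∞]` and its logarithm is `c`. -/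
def HasLambda {X ι : Type*} [MeasurableSpace X] (μ : ι → Measure X) (t : ι → ℝ)
    (l : Filter ι) (h : X → EReal) (c : EReal) : Prop :=
  ∃ L : ℝ≥0∞, Tendsto (fun a => powExp (μ a) (t a) h) l (𝓝 L) ∧ c = ENNReal.log L

/-- Exponential tightness of `μ` with respect to `t`. -/
def ExponentiallyTight {X ι : Type*} [TopologicalSpace X] [MeasurableSpace X]
    (μ : ι → Measure X) (t : ι → ℝ) (l : Filter ι) : Prop :=
  ∀ ε : ℝ≥0∞, 0 < ε → ∃ K : Set X, IsCompact K ∧ limsup (fun a => (μ a Kᶜ) ^ (t a)) l < ε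

/-- The large deviation upper bounds (on closed sets) with powers `t` and function `J`. -/
def UpperBounds {X ι : Type*} [TopologicalSpace X] [MeasurableSpace X]
    (μ : ι → Measure X) (t : ι → ℝ) (l : Filter ι) (J : X → ℝ≥0∞) : Prop :=
  ∀ F : Set X, IsClosed F →
    limsup (fun a => (μ a F) ^ (t a)) l ≤ (⨆ x ∈ F, EReal.exp (-(J x : EReal)))

/-- The large deviation lower bounds (on open sets) with powers `t` and function `J`. -/
def LowerBounds {X ι : Type*} [TopologicalSpace X] [MeasurableSpace X]
    (μ : ι → Measure X) (t : ι → ℝ) (l : Filter ι) (J : X → ℝ≥0∞) : Prop :=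
  ∀ G : Set X, IsOpen G →
    (⨆ x ∈ G, EReal.exp (-(J x : EReal))) ≤ liminf (fun a => (μ a G) ^ (t a)) l

/-- The large deviation principle with powers `t` and (lower semicontinuous, `[0,∞]`-valued)
rate function `J`. -/
structure LargeDeviationPrinciple {X ι : Type*} [TopologicalSpace X] [MeasurableSpace X]
    (μ : ι → Measure X) (t : ι → ℝ) (l : Filter ι) (J : X → ℝ≥0∞) : Prop where
  lowerSemicontinuous : LowerSemicontinuous J
  upper : UpperBounds μ t l J
  lower : LowerBounds μ t l J

/-- The set of all finite minima of continuous affine functionals `u + c`, with `u` in the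
topological dual and `c` real. -/
def affineMinima (X : Type*) [AddCommGroup X] [Module ℝ X] [TopologicalSpace X] :
    Set (X → ℝ) :=
  {h | ∃ (s : Finset ((X →L[ℝ] ℝ) × ℝ)) (hs : s.Nonempty),
    h = fun x => s.inf' hs (fun p => p.1 x + p.2)}

/-- The negative part of a set of real functions: its elements that are everywhere `≤ 0`. -/
def negPart {X : Type*} (A : Set (X → ℝ)) : Set (X → ℝ) :=
  {h | h ∈ A ∧ ∀ x, h x ≤ 0}

/-- A real function seen as an extended real function. -/
def ext {X : Type*} (h : X → ℝ) : X → EReal := fun x => (h x : EReal)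

open Classical in
/-- The function `h_M`, equal to `h` where `h < M` and to `-∞` where `h ≥ M`. -/
def trunc {X : Type*} (h : X → ℝ) (M : ℝ) : X → EReal :=
  fun x => if h x < M then (h x : EReal) else ⊥

end

end BrycLDP

/-! Take J to be the supremum over `negPart (affineMinima X)`. Chebyshev's inequality bounds the
mass near each point by roughly e^{-J}. Compactness and exponential tightness make this global,
since a union of n sets costs only the factor n^t → 1. For x in an open G, Hahn-Banach on a compact
K carrying most of the mass gives h ≤ 0 in the class with h(x) = 0 and h very negative on K \ G. The
integral of e^{h/t} then lives essentially on G, so e^{-J(x)} ≤ e^{Λ(h)} ≤ liminf μ(G)^t. The four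
formulas form a cycle: from J each supremum is at most the next by monotonicity, and the lower
bounds return the last one to J. -/

namespace BrycLDP

/-- Moves inequalities between possibly infinite logarithms to `ℝ≥0∞`, where no indeterminate
difference arises. -/
theorem coe_sub_log_le_iff (c : ℝ) (L : ℝ≥0∞) (J : EReal) :
    (c : EReal) - ENNReal.log L ≤ J ↔ EReal.exp c * EReal.exp (-J) ≤ L := by
  obtain ⟨y, rfl⟩ : ∃ y, L = EReal.exp y := ⟨ENNReal.log L, (ENNReal.exp_log L).symm⟩
  rw [EReal.log_exp, ← EReal.exp_add, EReal.exp_le_exp_iff]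
  induction y with
  | bot => induction J <;> simp [← EReal.coe_neg, ← EReal.coe_add]
  | top => simp
  | coe y =>
    induction J with
    | bot => simp [← EReal.coe_sub]
    | top => simp
    | coe z =>
      norm_cast
      constructor <;> intro h <;> linarith

theorem rpow_le_of_le_mul_rpow_inv {x r : ℝ≥0∞} {t : ℝ} (n : ℕ) (ht : 0 < t)
    (h : x ≤ n * r ^ t⁻¹) : x ^ t ≤ (n : ℝ≥0∞) ^ t * r := by
  calc x ^ t ≤ (n * r ^ t⁻¹) ^ t := ENNReal.rpow_le_rpow h ht.le
    _ = _ := by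
      rw [ENNReal.mul_rpow_of_nonneg _ _ ht.le, ← ENNReal.rpow_mul, inv_mul_cancel₀ ht.ne',
        ENNReal.rpow_one]

theorem eventually_natCast_rpow_mul_le {ι : Type*} {l : Filter ι} {t : ι → ℝ}
    (ht : Tendsto t l (𝓝 0)) (n : ℕ) (hn : n ≠ 0) {r r' : ℝ≥0∞} (h : r < r') :
    ∀ᶠ a in l, (n : ℝ≥0∞) ^ t a * r ≤ r' := by
  have h1 : Tendsto (fun a => (n : ℝ≥0∞) ^ t a) l (𝓝 1) := by
    have h2 : Tendsto (fun a => ENNReal.ofReal ((n : ℝ) ^ t a)) l (𝓝 (ENNReal.ofReal 1)) := by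
      refine ENNReal.tendsto_ofReal ?_
      have hn' : (n : ℝ) ≠ 0 := by exact_mod_cast hn
      simpa using tendsto_const_nhds.rpow ht (Or.inl hn')
    rw [ENNReal.ofReal_one] at h2
    refine h2.congr fun a => ?_
    rw [← ENNReal.ofReal_rpow_of_pos (by positivity), ENNReal.ofReal_natCast]
  have h3 := ENNReal.Tendsto.mul_const (b := r) h1 (Or.inl one_ne_zero)
  rw [one_mul] at h3
  exact (h3.eventually_lt_const h).mono fun _ h => h.le

theorem exp_div_rpow (c : ℝ) {t : ℝ} (ht : 0 < t) :
    EReal.exp ((c : EReal) / t) ^ t = EReal.exp c := by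
  rw [← EReal.exp_mul, EReal.div_mul_cancel] <;> simp [ht.ne']

theorem trunc_le_ext {X : Type*} (h : X → ℝ) (M : ℝ) (x : X) : trunc h M x ≤ ext h x := by
  unfold trunc ext
  split_ifs <;> simp

theorem trunc_mono {X : Type*} (h : X → ℝ) {M N : ℝ} (hMN : M ≤ N) (x : X) : trunc h M x ≤ trunc h N x := by
  unfold trunc
  split_ifs with h1 h2
  · exact le_rfl
  · exact absurd (h1.trans_le hMN) h2
  · exact bot_le
  · exact le_rfl

/-- A supremum of continuous functions: where `Λ h` is infinite, the difference is constant. -/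
theorem lowerSemicontinuous_of_eq_iSup_sub {X : Type*} [TopologicalSpace X] {A : Set (X → ℝ)}
    {Λ : (X → ℝ) → EReal} {J : X → ℝ≥0∞} (hA : ∀ h ∈ A, Continuous h)
    (hJ : ∀ x, (J x : EReal) = ⨆ h ∈ A, ((h x : EReal) - Λ h)) : LowerSemicontinuous J := by
  intro x y hy
  have hy' : (y : EReal) < J x := by exact_mod_cast hy
  have hsup : LowerSemicontinuous fun x => ⨆ h ∈ A, ((h x : EReal) - Λ h) := by
    refine lowerSemicontinuous_biSup fun h hh => Continuous.lowerSemicontinuous ?_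
    have hc := hA h hh
    induction Λ h with
    | bot => simpa using continuous_const
    | top => simpa using continuous_const
    | coe c =>
      simp only [← EReal.coe_sub]
      exact continuous_coe_real_ereal.comp (by fun_prop)
  rw [hJ] at hy'
  filter_upwards [hsup x _ hy'] with z hz
  rw [← hJ] at hz
  exact_mod_cast hz

/-! ### Monotonicity and Chebyshev bounds for the functionals -/

section

variable {X ι : Type*} [MeasurableSpace X]

theorem powExp_mono (μ : Measure X) {t : ℝ} (ht : 0 < t) {f g : X → EReal} (h : ∀ x, f x ≤ g x) :
    powExp μ t f ≤ powExp μ t g := by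
  refine ENNReal.rpow_le_rpow (lintegral_mono fun x => EReal.exp_monotone ?_) ht.le
  exact EReal.div_le_div_right_of_nonneg (by exact_mod_cast ht.le) (h x)

theorem exp_mul_measure_rpow_le_powExp (μ : Measure X) {t : ℝ} (ht : 0 < t) {V : Set X}
    (hV : MeasurableSet V) {c : ℝ} {f : X → EReal} (h : ∀ x ∈ V, (c : EReal) ≤ f x) :
    EReal.exp c * μ V ^ t ≤ powExp μ t f := by
  rw [← exp_div_rpow c ht, ← ENNReal.mul_rpow_of_nonneg _ _ ht.le]
  refine ENNReal.rpow_le_rpow ?_ ht.le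
  rw [← lintegral_indicator_const hV]
  refine lintegral_mono fun x => ?_
  by_cases hx : x ∈ V
  · rw [Set.indicator_of_mem hx]
    exact EReal.exp_monotone (EReal.div_le_div_right_of_nonneg (by exact_mod_cast ht.le) (h x hx))
  · simp [hx]

theorem lowerLambda_mono (μ : ι → Measure X) {t : ι → ℝ} (ht : ∀ a, 0 < t a) (l : Filter ι)
    {f g : X → EReal} (h : ∀ x, f x ≤ g x) : lowerLambda μ t l f ≤ lowerLambda μ t l g :=
  ENNReal.log_monotone
    (liminf_le_liminf (Eventually.of_forall fun a => powExp_mono (μ a) (ht a) h))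

theorem lowerLambda_le_upperLambda (μ : ι → Measure X) (t : ι → ℝ) (l : Filter ι) [l.NeBot]
    (f : X → EReal) : lowerLambda μ t l f ≤ upperLambda μ t l f :=
  ENNReal.log_monotone liminf_le_limsup

theorem HasLambda.upperLambda_eq {μ : ι → Measure X} {t : ι → ℝ} {l : Filter ι} [l.NeBot]
    {f : X → EReal} {c : EReal} (h : HasLambda μ t l f c) : upperLambda μ t l f = c := by
  obtain ⟨L, hL, rfl⟩ := h
  rw [upperLambda, hL.limsup_eq]

end

/-! ### Separation by minima of affine functionals -/

section

variable {X : Type*} [AddCommGroup X] [Module ℝ X] [TopologicalSpace X]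

theorem continuous_of_mem_affineMinima {h : X → ℝ} (hh : h ∈ affineMinima X) : Continuous h := by
  obtain ⟨s, hs, rfl⟩ := hh
  exact Continuous.finset_inf'_apply hs fun p _ => by fun_prop

theorem zero_mem_affineMinima : (fun _ => 0) ∈ affineMinima X :=
  ⟨{(0, 0)}, Finset.singleton_nonempty _, by simp⟩

theorem exists_mem_negPart_affineMinima [IsTopologicalAddGroup X] [ContinuousSMul ℝ X]
    [LocallyConvexSpace ℝ X] [T2Space X] {C : Set X} (hC : IsCompact C) {x : X} (hx : x ∉ C)
    (m : ℝ) : ∃ h ∈ negPart (affineMinima X), h x = 0 ∧ ∀ y ∈ C, h y ≤ m := by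
  classical
  have key : ∀ y ∈ C, ∃ v : X →L[ℝ] ℝ, v y - v x < m := by
    intro y hy
    obtain ⟨u, hu⟩ := geometric_hahn_banach_point_point (x := y) (y := x)
      (fun e => hx (e ▸ hy))
    -- Scaling the separating functional by n widens its gap between x and y beyond -m.
    obtain ⟨n, hn⟩ := exists_nat_gt (-m / (u x - u y))
    rw [div_lt_iff₀ (by linarith)] at hn
    refine ⟨(n : ℝ) • u, ?_⟩
    simp only [smul_apply, smul_eq_mul]
    linarith
  choose! v hv using key
  obtain ⟨s, hsC, hs⟩ := hC.elim_nhds_subcover (fun y => {z | v y z - v y x < m}) fun y hy =>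
    (isOpen_lt (by fun_prop) continuous_const).mem_nhds (hv y hy)
  -- The pair (0, 0) forces the minimum to be ≤ 0; every other member vanishes at x, so the value
  -- there is exactly 0.
  let S : Finset ((X →L[ℝ] ℝ) × ℝ) := insert (0, 0) (s.image fun y => (v y, -v y x))
  have hS : S.Nonempty := Finset.insert_nonempty _ _
  have h0 : ((0, 0) : (X →L[ℝ] ℝ) × ℝ) ∈ S := Finset.mem_insert_self _ _
  have hle : ∀ y, S.inf' hS (fun p => p.1 y + p.2) ≤ 0 := fun y =>
    (Finset.inf'_le (fun p : (X →L[ℝ] ℝ) × ℝ => p.1 y + p.2) h0).trans (by simp)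
  refine ⟨fun y => S.inf' hS fun p => p.1 y + p.2, ⟨⟨S, hS, rfl⟩, hle⟩,
    le_antisymm (hle x) (Finset.le_inf' _ _ ?_), fun y hy => ?_⟩
  · intro p hp
    rcases Finset.mem_insert.1 hp with rfl | hp
    · simp
    · obtain ⟨y, -, rfl⟩ := Finset.mem_image.1 hp
      simp
  · obtain ⟨z, hz, hyz⟩ := Set.mem_iUnion₂.1 (hs hy)
    have hzS : (v z, -v z x) ∈ S :=
      Finset.mem_insert_of_mem (Finset.mem_image_of_mem _ hz)
    refine (Finset.inf'_le (fun p : (X →L[ℝ] ℝ) × ℝ => p.1 y + p.2) hzS).trans ?_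
    have : v z y - v z x < m := hyz
    simp only
    linarith

end

/-! ### Large deviation bounds -/

section

variable {X ι : Type*} [TopologicalSpace X] [MeasurableSpace X] [BorelSpace X]
  {μ : ι → Measure X} {t : ι → ℝ} {l : Filter ι} {A : Set (X → ℝ)} {Λ : (X → ℝ) → EReal}
  {J : X → ℝ≥0∞}

/-- Some h nearly attains J(x), and Chebyshev's inequality applies on {h > c} with c just below
h(x). -/
theorem exists_nhds_eventually_measure_rpow_le (ht : ∀ a, 0 < t a) (hA : ∀ h ∈ A, Continuous h)
    (hΛ : ∀ h ∈ A, HasLambda μ t l (ext h) (Λ h))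
    (hJ : ∀ x, (J x : EReal) = ⨆ h ∈ A, ((h x : EReal) - Λ h))
    {x : X} {r : ℝ≥0∞} (hr : EReal.exp (-(J x : EReal)) < r) (hr' : r ≠ ⊤) :
    ∃ V ∈ 𝓝 x, ∀ᶠ a in l, μ a V ^ t a ≤ r := by
  have hlt : -ENNReal.log r < J x := by
    rw [EReal.neg_lt_comm]
    simpa using ENNReal.log_strictMono hr
  rw [hJ] at hlt
  simp only [lt_iSup_iff] at hlt
  obtain ⟨h, hh, hlt⟩ := hlt
  obtain ⟨L, hL, hLeq⟩ := hΛ h hh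
  have hLr : L < EReal.exp (h x) * r := by
    rw [hLeq, ← not_le, coe_sub_log_le_iff, not_le, neg_neg, ENNReal.exp_log] at hlt
    exact hlt
  have hcont : Tendsto (fun c : ℝ => EReal.exp c * r) (𝓝[<] (h x)) (𝓝 (EReal.exp (h x) * r)) :=
    (ENNReal.Tendsto.mul_const
      ((ENNReal.continuous_exp.comp continuous_coe_real_ereal).tendsto (h x))
      (Or.inr hr')).mono_left nhdsWithin_le_nhds
  obtain ⟨c, hcL, hc⟩ := ((hcont.eventually_const_lt hLr).and self_mem_nhdsWithin).exists
  have hVo : IsOpen {y | c < h y} := isOpen_lt continuous_const (hA h hh)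
  refine ⟨_, hVo.mem_nhds hc, ?_⟩
  filter_upwards [hL.eventually_lt_const hcL] with a ha
  have h1 := exp_mul_measure_rpow_le_powExp (μ a) (ht a) hVo.measurableSet (c := c) (f := ext h)
    fun y hy => EReal.coe_le_coe_iff.2 (le_of_lt hy)
  refine (ENNReal.mul_le_mul_iff_right ?_ ?_).1 (h1.trans ha.le)
  · simp [Real.exp_pos]
  · simp

theorem upperBounds_of_eq_iSup_sub (ht : ∀ a, 0 < t a) (ht0 : Tendsto t l (𝓝 0))
    (htight : ExponentiallyTight μ t l) (hA : ∀ h ∈ A, Continuous h)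
    (hΛ : ∀ h ∈ A, HasLambda μ t l (ext h) (Λ h))
    (hJ : ∀ x, (J x : EReal) = ⨆ h ∈ A, ((h x : EReal) - Λ h)) : UpperBounds μ t l J := by
  intro F hF
  refine le_of_forall_gt_imp_ge_of_dense fun r' hr' => ?_
  obtain ⟨r, hr, hrr'⟩ := exists_between hr'
  obtain ⟨K, hK, hKr⟩ := htight r (bot_le.trans_lt hr)
  have hV : ∀ x ∈ F ∩ K, ∃ V ∈ 𝓝 x, ∀ᶠ a in l, μ a V ^ t a ≤ r := fun x hx =>
    exists_nhds_eventually_measure_rpow_le ht hA hΛ hJ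
      ((le_iSup₂ (f := fun x (_ : x ∈ F) => EReal.exp (-(J x : EReal))) x hx.1).trans_lt hr)
      hrr'.ne_top
  choose! V hVx hVr using hV
  obtain ⟨s, hs, hsub⟩ := (hK.inter_left hF).elim_nhds_subcover V hVx
  refine limsup_le_of_le (by isBoundedDefault) ?_
  -- One extra piece accounts for the complement of K.
  filter_upwards [eventually_natCast_rpow_mul_le ht0 (s.card + 1) (Nat.succ_ne_zero _) hrr',
    eventually_lt_of_limsup_lt hKr, (Finset.eventually_all s).2 fun y hy => hVr y (hs y hy)]
    with a ha hKa hVa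
  refine (rpow_le_of_le_mul_rpow_inv (s.card + 1) (ht a) ?_).trans ha
  have hcover : F ⊆ (⋃ y ∈ s, V y) ∪ Kᶜ := fun z hz => by
    by_cases hzK : z ∈ K
    · exact Or.inl (hsub ⟨hz, hzK⟩)
    · exact Or.inr hzK
  calc μ a F ≤ μ a (⋃ y ∈ s, V y) + μ a Kᶜ := (measure_mono hcover).trans (measure_union_le _ _)
    _ ≤ ∑ y ∈ s, μ a (V y) + μ a Kᶜ := by gcongr; exact measure_biUnion_finset_le _ _
    _ ≤ ∑ _y ∈ s, r ^ (t a)⁻¹ + r ^ (t a)⁻¹ := by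
      gcongr with y hy
      · exact (ENNReal.le_rpow_inv_iff (ht a)).2 (hVa y hy)
      · exact (ENNReal.le_rpow_inv_iff (ht a)).2 hKa.le
    _ = _ := by simp [add_mul]

/-- Since h ≤ 0, the integrand is at most 1 on G and off K, and at most e^{m/s} on K \ G: three
pieces, hence the 3. -/
theorem powExp_le_of_union_bound [T2Space X] (ν : Measure X) [IsProbabilityMeasure ν] {s : ℝ}
    (hs : 0 < s) {G K : Set X} (hG : IsOpen G) (hK : IsCompact K) {h : X → ℝ} (hh : ∀ x, h x ≤ 0)
    {m : ℝ} (hm : ∀ x ∈ K \ G, h x ≤ m) {r : ℝ≥0∞} (hmr : EReal.exp m ≤ r) (hGr : ν G ^ s ≤ r)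
    (hKr : ν Kᶜ ^ s ≤ r) : powExp ν s (ext h) ≤ (3 : ℕ) ^ s * r := by
  refine rpow_le_of_le_mul_rpow_inv 3 hs ?_
  have hs' : (0 : EReal) ≤ s := by exact_mod_cast hs.le
  have hone : ∀ x, EReal.exp (ext h x / s) ≤ 1 := fun x => by
    rw [EReal.exp_le_one_iff]
    refine (EReal.div_le_div_right_of_nonneg hs' (b := 0) ?_).trans EReal.zero_div.le
    unfold ext
    exact_mod_cast hh x
  calc ∫⁻ x, EReal.exp (ext h x / s) ∂ν
      ≤ ∫⁻ x, (G.indicator (fun _ => 1) x + EReal.exp ((m : EReal) / s))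
          + Kᶜ.indicator (fun _ => 1) x ∂ν := by
        refine lintegral_mono fun x => ?_
        by_cases hxG : x ∈ G
        · simpa [hxG, add_assoc] using (hone x).trans le_self_add
        · by_cases hxK : x ∈ K
          · simp only [hxG, hxK, Set.indicator_of_notMem, Set.mem_compl_iff, not_true_eq_false,
              not_false_eq_true, zero_add, add_zero]
            exact EReal.exp_monotone (EReal.div_le_div_right_of_nonneg hs'
              (by unfold ext; exact_mod_cast hm x ⟨hxK, hxG⟩))
          · simpa [hxG, hxK] using (hone x).trans le_add_self
    _ = ν G + EReal.exp ((m : EReal) / s) + ν Kᶜ := by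
        rw [lintegral_add_right _ (measurable_const.indicator hK.isClosed.measurableSet.compl),
          lintegral_add_right _ measurable_const,
          lintegral_indicator_const hG.measurableSet,
          lintegral_indicator_const hK.isClosed.measurableSet.compl]
        simp
    _ ≤ r ^ s⁻¹ + r ^ s⁻¹ + r ^ s⁻¹ := by
        gcongr
        · exact (ENNReal.le_rpow_inv_iff hs).2 hGr
        · exact (ENNReal.le_rpow_inv_iff hs).2 (by rwa [exp_div_rpow m hs])
        · exact (ENNReal.le_rpow_inv_iff hs).2 hKr
    _ = (3 : ℕ) * r ^ s⁻¹ := by push_cast; ring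

theorem lowerBounds_of_eq_iSup_sub [T2Space X] [l.NeBot] [∀ a, IsProbabilityMeasure (μ a)]
    (ht : ∀ a, 0 < t a) (ht0 : Tendsto t l (𝓝 0)) (htight : ExponentiallyTight μ t l)
    (hsep : ∀ C : Set X, IsCompact C → ∀ x ∉ C, ∀ m : ℝ, ∃ h ∈ negPart A,
      h x = 0 ∧ ∀ y ∈ C, h y ≤ m)
    (hΛ : ∀ h ∈ negPart A, HasLambda μ t l (ext h) (Λ h))
    (hJ : ∀ x, (J x : EReal) = ⨆ h ∈ negPart A, ((h x : EReal) - Λ h)) :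
    LowerBounds μ t l J := by
  intro G hG
  refine iSup₂_le fun x hx => le_of_not_gt fun hlt => ?_
  obtain ⟨r, hr, hrJ⟩ := exists_between hlt
  obtain ⟨r', hrr', hr'J⟩ := exists_between hrJ
  have hr0 : 0 < r := bot_le.trans_lt hr
  obtain ⟨K, hK, hKr⟩ := htight r hr0
  obtain ⟨m, hm⟩ : ∃ m : ℝ, EReal.exp m ≤ r := by
    refine ⟨(ENNReal.log r).toReal, ?_⟩
    rw [EReal.coe_toReal (by simpa using hrr'.ne_top) (by simpa using hr0.ne'), ENNReal.exp_log]
  obtain ⟨h, hh, hx0, hhm⟩ := hsep (K \ G) (hK.diff hG) x (fun hx' => hx'.2 hx) m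
  obtain ⟨L, hL, hLeq⟩ := hΛ h hh
  have hJL : EReal.exp (-(J x : EReal)) ≤ L := by
    have h1 : (h x : EReal) - Λ h ≤ J x := by
      rw [hJ]
      exact le_iSup₂ (f := fun h (_ : h ∈ negPart A) => ((h x : EReal) - Λ h)) h hh
    rw [hLeq, coe_sub_log_le_iff, hx0] at h1
    simpa using h1
  -- A strict bound on a liminf holds only frequently; this suffices because L is a genuine limit.
  have hfreq : ∃ᶠ a in l, powExp (μ a) (t a) (ext h) ≤ r' := by
    refine (frequently_lt_of_liminf_lt (by isBoundedDefault) hr).mp ?_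
    filter_upwards [eventually_natCast_rpow_mul_le ht0 3 three_ne_zero hrr',
      eventually_lt_of_limsup_lt hKr] with a ha hKa hGa
    exact (powExp_le_of_union_bound (μ a) (ht a) hG hK hh.2 hhm hm hGa.le hKa.le).trans ha
  exact absurd ((hJL.trans (le_of_tendsto_of_frequently hL hfreq)).trans_lt hr'J) (lt_irrefl _)

theorem LowerBounds.coe_sub_iSup_lowerLambda_trunc_le [l.NeBot] (ht : ∀ a, 0 < t a)
    (hlow : LowerBounds μ t l J) {h : X → ℝ} (hh : Continuous h) (x : X) :
    (h x : EReal) - ⨆ M : ℝ, lowerLambda μ t l (trunc h M) ≤ J x := by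
  obtain ⟨L, hL⟩ := ENNReal.log_surjective (⨆ M : ℝ, lowerLambda μ t l (trunc h M))
  rw [← hL, coe_sub_log_le_iff]
  have hcont : Tendsto (fun c : ℝ => EReal.exp c * EReal.exp (-(J x : EReal))) (𝓝[<] (h x))
      (𝓝 (EReal.exp (h x) * EReal.exp (-(J x : EReal)))) :=
    (ENNReal.Tendsto.mul_const
      ((ENNReal.continuous_exp.comp continuous_coe_real_ereal).tendsto (h x))
      (Or.inr (by simp))).mono_left nhdsWithin_le_nhds
  refine le_of_tendsto hcont (eventually_nhdsWithin_of_forall fun c hc => ?_)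
  -- The cap h(x) + 1 makes the truncation at that level agree with h on this set.
  have hGo : IsOpen {y | c < h y ∧ h y < h x + 1} :=
    (isOpen_lt continuous_const hh).inter (isOpen_lt hh continuous_const)
  have h1 : EReal.exp (-(J x : EReal)) ≤
      liminf (fun a => μ a {y | c < h y ∧ h y < h x + 1} ^ t a) l :=
    (le_iSup₂ (f := fun z (_ : z ∈ {y | c < h y ∧ h y < h x + 1}) =>
      EReal.exp (-(J z : EReal))) x ⟨hc, lt_add_one _⟩).trans (hlow _ hGo)
  have h2 : EReal.exp c * EReal.exp (-(J x : EReal)) ≤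
      liminf (fun a => powExp (μ a) (t a) (trunc h (h x + 1))) l := by
    calc _ ≤ EReal.exp c * liminf (fun a => μ a {y | c < h y ∧ h y < h x + 1} ^ t a) l := by
          gcongr
      _ = liminf (fun a => EReal.exp c * μ a {y | c < h y ∧ h y < h x + 1} ^ t a) l :=
          (ENNReal.liminf_const_mul_of_ne_top (by simp)).symm
      _ ≤ _ := liminf_le_liminf (Eventually.of_forall fun a =>
          exp_mul_measure_rpow_le_powExp (μ a) (ht a) hGo.measurableSet fun y hy => by
            rw [trunc, if_pos hy.2]
            exact_mod_cast hy.1.le)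
  refine h2.trans ?_
  rw [← ENNReal.log_le_log_iff, hL]
  exact le_iSup (fun M : ℝ => lowerLambda μ t l (trunc h M)) (h x + 1)

end

end BrycLDP

theorem mainTheorem6
    {X : Type*} [AddCommGroup X] [Module ℝ X] [TopologicalSpace X] [IsTopologicalAddGroup X]
    [ContinuousSMul ℝ X] [LocallyConvexSpace ℝ X] [T2Space X]
    [MeasurableSpace X] [BorelSpace X]
    {ι : Type*} [Preorder ι] [IsDirectedOrder ι] [Nonempty ι]
    (μ : ι → Measure X) [∀ a, IsProbabilityMeasure (μ a)]
    (t : ι → ℝ) (ht_pos : ∀ a, 0 < t a) (ht_lim : Tendsto t atTop (𝓝 0))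
    (htight : BrycLDP.ExponentiallyTight μ t atTop)
    (Λ : (X → ℝ) → EReal)
    (hΛ : ∀ h ∈ BrycLDP.negPart (BrycLDP.affineMinima X),
      BrycLDP.HasLambda μ t atTop (BrycLDP.ext h) (Λ h)) :
    ∃ (J : X → ℝ≥0∞) (Λtr : (X → ℝ) → EReal),
      BrycLDP.LargeDeviationPrinciple μ t atTop J ∧
      (∀ h ∈ BrycLDP.affineMinima X,
        Tendsto (fun M : ℝ => BrycLDP.lowerLambda μ t atTop (BrycLDP.trunc h M)) atTop
          (𝓝 (Λtr h))) ∧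
      ∀ x : X,
        (J x : EReal) =
          (⨆ h ∈ BrycLDP.negPart (BrycLDP.affineMinima X), ((h x : EReal) - Λ h)) ∧
        (J x : EReal) = (⨆ h ∈ BrycLDP.affineMinima X,
          ((h x : EReal) - BrycLDP.upperLambda μ t atTop (BrycLDP.ext h))) ∧
        (J x : EReal) = (⨆ h ∈ BrycLDP.affineMinima X,
          ((h x : EReal) - BrycLDP.lowerLambda μ t atTop (BrycLDP.ext h))) ∧
        (J x : EReal) = (⨆ h ∈ BrycLDP.affineMinima X, ((h x : EReal) - Λtr h)) := by
  have hcont : ∀ h ∈ BrycLDP.affineMinima X, Continuous h := fun h hh =>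
    BrycLDP.continuous_of_mem_affineMinima hh
  have hnonneg : ∀ x : X,
      (0 : EReal) ≤ ⨆ h ∈ BrycLDP.negPart (BrycLDP.affineMinima X), ((h x : EReal) - Λ h) := by
    intro x
    have h0 : (fun _ => 0) ∈ BrycLDP.negPart (BrycLDP.affineMinima X) :=
      ⟨BrycLDP.zero_mem_affineMinima, fun _ => le_rfl⟩
    -- The zero function has Λ = 0, as the measures are probabilities; hence `toENNReal` below loses
    -- nothing.
    refine le_trans ?_ (le_iSup₂ _ h0)
    obtain ⟨L, hL, hLeq⟩ := hΛ _ h0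
    have : L = 1 := tendsto_nhds_unique hL (by simp [BrycLDP.powExp, BrycLDP.ext])
    simp [hLeq, this]
  let J : X → ℝ≥0∞ := fun x =>
    (⨆ h ∈ BrycLDP.negPart (BrycLDP.affineMinima X), ((h x : EReal) - Λ h)).toENNReal
  have hJ : ∀ x, (J x : EReal) =
      ⨆ h ∈ BrycLDP.negPart (BrycLDP.affineMinima X), ((h x : EReal) - Λ h) := fun x =>
    EReal.coe_toENNReal (hnonneg x)
  have hlow : BrycLDP.LowerBounds μ t atTop J :=
    BrycLDP.lowerBounds_of_eq_iSup_sub ht_pos ht_lim htight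
      (fun C hC x hx m => BrycLDP.exists_mem_negPart_affineMinima hC hx m) hΛ hJ
  refine ⟨J, fun h => ⨆ M : ℝ, BrycLDP.lowerLambda μ t atTop (BrycLDP.trunc h M),
    ⟨BrycLDP.lowerSemicontinuous_of_eq_iSup_sub (fun h hh => hcont h hh.1) hJ,
      BrycLDP.upperBounds_of_eq_iSup_sub ht_pos ht_lim htight (fun h hh => hcont h hh.1) hΛ hJ,
      -- Raising M increases the truncation, so the limit is a supremum.
      hlow⟩, fun h _ => tendsto_atTop_iSup fun M N hMN =>
        BrycLDP.lowerLambda_mono μ ht_pos atTop (BrycLDP.trunc_mono h hMN), fun x => ?_⟩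
  have h12 : (J x : EReal) ≤ ⨆ h ∈ BrycLDP.affineMinima X,
      ((h x : EReal) - BrycLDP.upperLambda μ t atTop (BrycLDP.ext h)) := by
    rw [hJ]
    refine iSup₂_le fun h hh => ?_
    rw [← (hΛ h hh).upperLambda_eq]
    exact le_iSup₂ (f := fun h (_ : h ∈ BrycLDP.affineMinima X) =>
      ((h x : EReal) - BrycLDP.upperLambda μ t atTop (BrycLDP.ext h))) h hh.1
  have h23 : (⨆ h ∈ BrycLDP.affineMinima X,
      ((h x : EReal) - BrycLDP.upperLambda μ t atTop (BrycLDP.ext h))) ≤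
      ⨆ h ∈ BrycLDP.affineMinima X,
        ((h x : EReal) - BrycLDP.lowerLambda μ t atTop (BrycLDP.ext h)) :=
    iSup₂_mono fun h _ =>
      EReal.sub_le_sub le_rfl (BrycLDP.lowerLambda_le_upperLambda μ t atTop _)
  have h34 : (⨆ h ∈ BrycLDP.affineMinima X,
      ((h x : EReal) - BrycLDP.lowerLambda μ t atTop (BrycLDP.ext h))) ≤
      ⨆ h ∈ BrycLDP.affineMinima X,
        ((h x : EReal) - ⨆ M : ℝ, BrycLDP.lowerLambda μ t atTop (BrycLDP.trunc h M)) :=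
    iSup₂_mono fun h _ => EReal.sub_le_sub le_rfl (iSup_le fun M =>
      BrycLDP.lowerLambda_mono μ ht_pos atTop (BrycLDP.trunc_le_ext h M))
  have h41 : (⨆ h ∈ BrycLDP.affineMinima X,
      ((h x : EReal) - ⨆ M : ℝ, BrycLDP.lowerLambda μ t atTop (BrycLDP.trunc h M))) ≤ J x :=
    iSup₂_le fun h hh => hlow.coe_sub_iSup_lowerLambda_trunc_le ht_pos (hcont h hh) x
  exact ⟨hJ x, h12.antisymm (h23.trans (h34.trans h41)),
    (h12.trans h23).antisymm (h34.trans h41), (h12.trans (h23.trans h34)).antisymm h41⟩
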